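/- **Setting.** Let $\mathcal X$ be a Polish space with its Borel $\sigma$-algebra, let $\mathcal Y$ be a finite set, and let $\mathcal S=2^{\mathcal Y}$. Let $\ell:\mathcal Y\times\mathcal Y\to\mathbb R$ be a proper loss, i.e. $\ell\ge 0$ and $\ell(z,y)=0$ if and only if $z=y$. Let $L(z,S)=\inf_{y\in S}\ell(z,y)$ be the infimum loss, and for a probability measure $\rho$ on $\mathcal X\times\mathcal Y$ and a measurable $f:\mathcal X\to\mathcal Y$ let $\mathcal R(f;\rho)=\mathbb E_{(X,Y)\sim\rho}[\ell(f(X),Y)]$. Let $\tau$ be a probability measure on $\mathcal X\times\mathcal S$, with marginal $\tau_{\mathcal X}$ on $\mathcal X$ and conditional distributions $\tau|_x$ on $\mathcal S$, and let $S_x=\bigcap_{S\in\operatorname{supp}(\tau|_x)}S$. Let $\eta\in(0,1)$ and assume that $\tau$ is $\eta$-strictly non-ambiguous: for ($\tau_{\mathcal X}$-almost) every $x$, the set $S_x$ is a singleton and $\mathbb P_{S\sim\tau|_x}(z\in S)\le 1-\eta$ for all $z\notin S_x$. A probability measure $\rho$ on $\mathcal X\times\mathcal Y$ is eligible for $\tau$,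 written $\rho\vdash\tau$, if some probability measure $\pi$ on $\mathcal X\times\mathcal Y\times\mathcal S$ has marginals $\rho$ on $\mathcal X\times\mathcal Y$ and $\tau$ on $\mathcal X\times\mathcal S$, and satisfies $\pi(\{(x,y,S): y\notin S\})=0$. Let $$\rho^\star\in\operatorname*{arg\,min}_{\rho\vdash\tau}\ \inf_{f}\mathcal R(f;\rho),\qquad f^*\in\operatorname*{arg\,min}_{f}\mathcal R(f;\rho^\star),$$ with $f$ ranging over the measurable functions $\mathcal X\to\mathcal Y$. Let $k:\mathcal X\times\mathcal X\to\mathbb R$ be a bounded continuous positive-definite kernel (symmetric, with $\sum_{i,j}c_ic_jk(x_i,x_j)\ge0$ for all finite families) which is universal: for every compact $Z\subset\mathcal X$ the span of $\{k(\cdot,z):z\in Z\}$ is uniformly dense in $C(Z)$. Let $\mathcal H$ be a real Hilbert space and $\psi:\mathcal Y\to\mathcal H$, $\phi:\mathcal S\to\mathcal H$ maps such that $L(z,S)=\langle\psi(z),\phi(S)\rangle$ for all $z\in\mathcal Y$ and all nonempty $S\in\mathcal S$. Assume that the conditional mean $$g(x)=\mathbb E_{S\sim\tau|_x}[\phi(S)]$$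 belongs (up to a $\tau_{\mathcal X}$-null set) to the $\mathcal H$-valued reproducing kernel Hilbert space with kernel $k(x,x')\,\mathrm{Id}_{\mathcal H}$. For $n\ge1$ and data $(x_i,S_i)_{i\le n}\sim\tau^{\otimes n}$ let $\lambda=n^{-1/2}$, $K=(k(x_i,x_j))_{i,j}$, $v(x)=(k(x,x_i))_i$, $\alpha(x)=(K+n\lambda I)^{-1}v(x)\in\mathbb R^n$, and let $f_n:\mathcal X\to\mathcal Y$ be a measurable function with $$f_n(x)\in\operatorname*{arg\,min}_{z\in\mathcal Y}\ \sum_{i=1}^n\alpha_i(x)\,\inf_{y\in S_i}\ell(z,y)\qquad\text{for all }x\in\mathcal X.$$ **Claim.** There exists a constant $\tilde C$, independent of $n$ and $\delta$, such that for all $\delta\in(0,1)$ and all integers $n\ge1$, with probability at least $1-\delta$ over the data, every such $f_n$ satisfies $$\mathcal R(f_n;\rho^\star)-\mathcal R(f^*;\rho^\star)\ \le\ \tilde C\,\bigl(\log(8/\delta)\bigr)^2\,n^{-1/4}.$$ -/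

import Mathlib

open MeasureTheory

noncomputable section

namespace PartialLabel

/-! ### Losses, risks and weak distributions

`X` is the input space and `Y` the (finite) output space. The observation space, made of all closed
subsets of `Y`, is `Set Y`: every subset of a finite Hausdorff space is closed, and the σ-algebra of
`Set Y` is the discrete one when `Y` is finite. -/

section Risk

variable {X Y : Type*}

/-- A proper loss: nonnegative, zero on the diagonal and positive off it
(continuity is automatic on a finite output space). -/
def IsProperLoss (loss : Y → Y → ℝ) : Prop :=
  ∀ z y, 0 ≤ loss z y ∧ (loss z y = 0 ↔ z = y)

/-- The infimum loss `L(z, S) = inf_{y ∈ S} loss(z, y)` (only meaningful for nonempty `S`). -/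
def infLoss (loss : Y → Y → ℝ) (z : Y) (S : Set Y) : ℝ :=
  sInf (loss z '' S)

variable [MeasurableSpace X] [MeasurableSpace Y]

/-- The risk `R(f; ρ) = E_{(X, Y) ∼ ρ} [loss (f X) Y]`. -/
def risk (loss : Y → Y → ℝ) (ρ : Measure (X × Y)) (f : X → Y) : ℝ :=
  ∫ p, loss (f p.1) p.2 ∂ρ

/-- `f` minimizes `R(· ; ρ)` among measurable functions. -/
def IsRiskMinimizer (loss : Y → Y → ℝ) (ρ : Measure (X × Y)) (f : X → Y) : Prop :=
  Measurable f ∧ ∀ f' : X → Y, Measurable f' → risk loss ρ f ≤ risk loss ρ f'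

/-- The variability `E(ρ) = inf_f R(f; ρ)`, over measurable `f`. -/
def variability (loss : Y → Y → ℝ) (ρ : Measure (X × Y)) : ℝ :=
  ⨅ f : {f : X → Y // Measurable f}, risk loss ρ f.1

/-- `ρ` is eligible for `τ`: there is a coupling `π` on `X × Y × Set Y` with marginals `ρ` and `τ`
under which the label belongs to the observed set almost surely. -/
def Eligible (ρ : Measure (X × Y)) (τ : Measure (X × Set Y)) : Prop :=
  ∃ π : Measure (X × Y × Set Y), IsProbabilityMeasure π ∧
    π.map (fun p => (p.1, p.2.1)) = ρ ∧
    π.map (fun p => (p.1, p.2.2)) = τ ∧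
    π {p | p.2.1 ∉ p.2.2} = 0

/-- `ρ` solves the minimum variability principle: it minimizes the variability among all the
probability measures that are eligible for `τ`. -/
def IsMinVariability (loss : Y → Y → ℝ) (τ : Measure (X × Set Y)) (ρ : Measure (X × Y)) : Prop :=
  IsProbabilityMeasure ρ ∧ Eligible ρ τ ∧
    ∀ ρ' : Measure (X × Y), IsProbabilityMeasure ρ' → Eligible ρ' τ →
      variability loss ρ ≤ variability loss ρ'

/-- The intersection of all the sets in the support of `μ`. For finite `Y` the space `Set Y` is
finite and discrete, so that the support is the set of atoms. -/
def commonLabels (μ : Measure (Set Y)) : Set Y :=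
  ⋂ S ∈ {S : Set Y | μ {S} ≠ 0}, S

/-- Non-ambiguity, `τ.condKernel x` being the conditional distribution of the observed set given
the input `x`. As conditional distributions are unique only up to a null set of inputs, the
condition is imposed at almost every input. -/
def NonAmbiguous [Finite Y] [MeasurableSingletonClass Y] (τ : Measure (X × Set Y))
    [IsFiniteMeasure τ] : Prop :=
  ∀ᵐ x ∂τ.fst, ∃ y, commonLabels (τ.condKernel x) = {y}

/-- `η`-strict non-ambiguity. -/
def StrictlyNonAmbiguous [Finite Y] [MeasurableSingletonClass Y] (η : ℝ)
    (τ : Measure (X × Set Y)) [IsFiniteMeasure τ] : Prop :=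
  NonAmbiguous τ ∧
    ∀ᵐ x ∂τ.fst, ∀ z, z ∉ commonLabels (τ.condKernel x) →
      (τ.condKernel x).real {S | z ∈ S} ≤ 1 - η

/-- The conditional mean `g(x) = E[φ(S) | X = x]`. -/
def condMean [Finite Y] [MeasurableSingletonClass Y] {H : Type*} [NormedAddCommGroup H]
    [NormedSpace ℝ H] (τ : Measure (X × Set Y)) [IsFiniteMeasure τ] (φ : Set Y → H) (x : X) : H :=
  ∫ S, φ S ∂(τ.condKernel x)

end Risk

/-! ### Kernels -/

section Kernels

variable {X : Type*}

/-- A positive-definite kernel: symmetric, and `∑ i j, c i * c j * k (x i) (x j) ≥ 0` for all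
finitely supported families of coefficients. -/
def IsPosDefKernel (k : X → X → ℝ) : Prop :=
  (Matrix.of k).PosSemidef

/-- A universal kernel: on each compact set `Z`, the linear combinations of the functions
`k(·, z)`, `z ∈ Z`, are uniformly dense in the continuous functions. -/
def IsUniversalKernel [TopologicalSpace X] (k : X → X → ℝ) : Prop :=
  ∀ Z : Set X, IsCompact Z → ∀ f : X → ℝ, ContinuousOn f Z → ∀ ε > 0,
    ∃ c : X →₀ ℝ, (↑c.support : Set X) ⊆ Z ∧
      ∀ x ∈ Z, |f x - c.sum (fun z a => a * k x z)| < ε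

/-- The operator-valued kernel `k(x, y) • Id_H`. -/
def opKernel (k : X → X → ℝ) (H : Type*) [NormedAddCommGroup H] [InnerProductSpace ℝ H] :
    Matrix X X (H →L[ℝ] H) :=
  Matrix.of fun x y => k x y • ContinuousLinearMap.id ℝ H

/-- The operator-valued kernel of a positive-definite kernel is positive semidefinite. -/
theorem opKernel_posSemidef {H : Type*} [NormedAddCommGroup H] [InnerProductSpace ℝ H]
    [CompleteSpace H] {k : X → X → ℝ} (hk : IsPosDefKernel k) : (opKernel k H).PosSemidef := by
  have hsymm : ∀ x y, k y x = k x y := fun x y => by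
    have h := hk.1.apply x y
    simpa using h
  suffices hs : (opKernel k H).IsHermitian ∧ ∀ vv : X →₀ H, 0 ≤ RCLike.re (K := ℝ)
      (vv.sum fun x w => vv.sum fun x' w' => inner ℝ (opKernel k H x' x w) w') from
    ((RKHS.posSemidef_tfae (𝕜 := ℝ) (K := opKernel k H)).out 0 2 :
      (opKernel k H).PosSemidef ↔ _).mpr hs
  refine ⟨?_, fun vv => ?_⟩
  · ext x y v
    simp [opKernel, Matrix.conjTranspose_apply, hsymm x y, ContinuousLinearMap.star_eq_adjoint,
      ContinuousLinearMap.adjoint_id]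
  · have hA := hk.submatrix (fun i : vv.support => (i : X))
    have hB := Matrix.posSemidef_gram ℝ (fun i : vv.support => vv (i : X))
    have h := (hA.hadamard hB).dotProduct_mulVec_nonneg (fun _ => 1)
    simp only [dotProduct, Matrix.mulVec, Matrix.hadamard_apply, Matrix.submatrix_apply,
      Matrix.of_apply, Matrix.gram_apply, Pi.star_apply, star_trivial, one_mul, mul_one] at h
    simp only [Finsupp.sum, opKernel, Matrix.of_apply, RCLike.re_to_real]
    rw [← Finset.sum_coe_sort]
    refine h.trans_eq (Finset.sum_congr rfl fun i _ => ?_)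
    rw [← Finset.sum_coe_sort vv.support]
    refine Finset.sum_congr rfl fun j _ => ?_
    simp [real_inner_smul_left, hsymm i j]

/-- `f : X → H` belongs to the `H`-valued reproducing kernel Hilbert space of `k`, that is, to the
one whose reproducing kernel is `k(x, y) • Id_H` (see `opKernel_posSemidef` for the positivity
that its construction uses). -/
def MemRKHS {H : Type*} [NormedAddCommGroup H] [InnerProductSpace ℝ H] [CompleteSpace H]
    (k : X → X → ℝ) (f : X → H) : Prop :=
  ∃ h : (opKernel k H).PosSemidef,
    haveI : Fact (opKernel k H).PosSemidef := ⟨h⟩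
    ∃ G : RKHS.OfKernel (opKernel k H), ∀ x, G x = f x

end Kernels

/-! ### The estimator -/

section Estimator

variable {X Y : Type*}

/-- Kernel ridge regression weights `α(x) = (K + n reg I)⁻¹ v(x)`, with
`K = (k (x i) (x j))_{i, j}` and `v(x) = (k x (x i))_i`. -/
def ridgeWeights (k : X → X → ℝ) (reg : ℝ) {n : ℕ} (xs : Fin n → X) (x : X) : Fin n → ℝ :=
  Matrix.mulVec
    (Matrix.of (fun i j => k (xs i) (xs j)) + ((n : ℝ) * reg) • (1 : Matrix (Fin n) (Fin n) ℝ))⁻¹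
    (fun i => k x (xs i))

/-- `f` is an estimator trained on the data `D`: a measurable function such that, for each `x`,
`f x` minimizes over `z` the mean infimum loss `∑ i, α i (x) * inf_{y ∈ S i} loss(z, y)` under the
plug-in approximation `∑ i, α i (x) δ_{S i}` of the conditional distribution. -/
def IsEstimator [MeasurableSpace X] [MeasurableSpace Y] (loss : Y → Y → ℝ) (k : X → X → ℝ)
    (reg : ℝ) {n : ℕ} (D : Fin n → X × Set Y) (f : X → Y) : Prop :=
  Measurable f ∧ ∀ x z,
    ∑ i, ridgeWeights k reg (fun j => (D j).1) x i * infLoss loss (f x) (D i).2 ≤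
      ∑ i, ridgeWeights k reg (fun j => (D j).1) x i * infLoss loss z (D i).2

end Estimator

end PartialLabel

end

open PartialLabel

/-!
# Learning rate of disambiguation from partial labels

**Reduction to regression.** Under non-ambiguity the distribution concentrated on the unique common
label of each input is eligible and has variability zero. Hence the minimum variability is zero, the
optimal predictor `fstar` has risk zero, and `fstar x` is almost surely that common label
(`IsMinVariability.ae_eq_of_isRiskMinimizer`, `Eligible.ae_mem`). Strictness makes the infimum loss
calibrated: `loss z (fstar x)` is at most a constant times the conditional infimum risk of `z`, and
the one of `fstar x` vanishes (`exists_loss_le_mul_integral_infLoss`). As the estimator minimizes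
estimates of these conditional risks, its risk is bounded by the sum over `z : Y` of the `L¹` errors
of these estimates (`sub_le_two_mul_sum_abs_sub`). They are finitely many scalar kernel ridge
regressions, whose targets `⟪ψ z, g x⟫` are coordinates of the conditional mean and hence of the form
`⟪Φ x, h⟫` for a feature map `Φ` of `k` (`MemRKHS.exists_featureMap`).

**Ridge regression.** The estimate is `⟪Φ x, u⟫`, where `u` solves a normal equation with
regularization constant `n * reg = √n`. Let `w = u - h`. Testing the normal equation against `w`
(`ridge_energy_bound`) gives
`√n * ‖w‖ ^ 2 + ∑ i, ⟪Φ (x i), w⟫ ^ 2 ≤ (‖∑ i, ξ i‖ + √n * ‖h‖) * ‖w‖`, with centred noise vectors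
`ξ i`. If `‖∑ i, ξ i‖` is of order `√n`, then `‖w‖` is bounded, and the empirical mean of `⟪Φ, w⟫ ^ 2`
is of order `1 / √n`. Its deviation from the population mean is at most
`‖w‖ ^ 2` times the norm of a centred empirical mean of `Φ ⊗ Φ`, again of order `1 / √n`. Taking a
square root yields the rate `n ^ (-1/4)`. No effective dimension or source condition enters.

**Concentration.** Both deviations are norms of sums of independent centred bounded vectors in a
Hilbert space. They are bounded through the exponential moment `E cosh (t * ‖∑ i, ξ i‖)`, as in
Pinelis' inequality (`cosh_norm_add_le`, `measure_norm_sum_ge_le`).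
-/

namespace PartialLabel

/-! ### Concentration in Hilbert spaces -/

/-- `x ↦ cosh √x` is convex on `[0, ∞)`, since its power series has nonnegative coefficients. -/
theorem cosh_le_of_sq_eq {r u v θ : ℝ} (hθ0 : 0 ≤ θ) (hθ1 : θ ≤ 1)
    (h : r ^ 2 = θ * u ^ 2 + (1 - θ) * v ^ 2) :
    Real.cosh r ≤ θ * Real.cosh u + (1 - θ) * Real.cosh v := by
  refine hasSum_le (fun n => ?_) (Real.hasSum_cosh r)
    (((Real.hasSum_cosh u).mul_left θ).add ((Real.hasSum_cosh v).mul_left (1 - θ)))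
  have hc := (convexOn_pow n).2 (Set.mem_Ici.2 (sq_nonneg u)) (Set.mem_Ici.2 (sq_nonneg v))
    hθ0 (sub_nonneg.2 hθ1) (by ring)
  simp only [smul_eq_mul, ← h, ← pow_mul] at hc
  rw [← mul_div_assoc, ← mul_div_assoc, ← add_div]
  gcongr

section Concentration

variable {E : Type*} [NormedAddCommGroup E] [InnerProductSpace ℝ E]

/-- The one-step inequality behind concentration in Hilbert spaces. By convexity of `cosh √x`, the
left side is at most its interpolation between `x` parallel and antiparallel to `s`, which is
`cosh ‖s‖ * cosh ‖x‖ + sinh ‖s‖ * sinh ‖x‖ * cos θ`. The last term is linear in `x` up to an error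
`sinh ‖s‖ * (sinh ‖x‖ - ‖x‖)`. -/
theorem cosh_norm_add_le (s x : E) :
    Real.cosh ‖s + x‖ ≤ Real.cosh ‖s‖ * (Real.exp ‖x‖ - ‖x‖) +
      inner ℝ ((Real.sinh ‖s‖ / ‖s‖) • s) x := by
  rcases eq_or_ne s 0 with rfl | hs
  · have h1 := Real.cosh_add_sinh ‖x‖
    have h2 := Real.self_le_sinh_iff.2 (norm_nonneg x)
    simp; linarith
  rcases eq_or_ne x 0 with rfl | hx
  · simp
  have ha := norm_pos_iff.2 hs
  have hb := norm_pos_iff.2 hx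
  have hp := abs_le.1 (abs_real_inner_le_norm s x)
  have hsq := norm_add_sq_real s x
  rw [real_inner_smul_left]
  set a := ‖s‖
  set b := ‖x‖
  set p := inner ℝ s x
  have hq1 : p / (a * b) ≤ 1 := by rw [div_le_one (by positivity)]; exact hp.2
  have hq2 : -1 ≤ p / (a * b) := by rw [le_div_iff₀ (by positivity)]; linarith [hp.1]
  have hpq : p = (p / (a * b)) * (a * b) := by field_simp
  set q := p / (a * b)
  have h := cosh_le_of_sq_eq (r := ‖s + x‖) (u := a + b) (v := a - b) (θ := (1 + q) / 2)
    (by linarith) (by linarith) (by rw [hsq, hpq]; ring)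
  rw [Real.cosh_add, Real.cosh_sub] at h
  have hsb := Real.self_le_sinh_iff.2 hb.le
  have hsa := Real.sinh_lt_cosh a
  have hsa0 : 0 ≤ Real.sinh a := Real.sinh_nonneg_iff.2 ha.le
  have e1 : Real.sinh a / a * p = Real.sinh a * (q * b) := by rw [hpq]; field_simp
  rw [e1, ← Real.cosh_add_sinh b]
  have k1 : q * (Real.sinh a * (Real.sinh b - b)) ≤ 1 * (Real.sinh a * (Real.sinh b - b)) :=
    mul_le_mul_of_nonneg_right hq1 (mul_nonneg hsa0 (by linarith))
  have k2 : Real.sinh a * (Real.sinh b - b) ≤ Real.cosh a * (Real.sinh b - b) :=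
    mul_le_mul_of_nonneg_right hsa.le (by linarith)
  nlinarith [h, k1, k2]

variable {Ω : Type*} [MeasurableSpace Ω]

omit [InnerProductSpace ℝ E] in
theorem integrable_cosh_norm {μ : Measure Ω} [IsFiniteMeasure μ] {f : Ω → E}
    (hf : StronglyMeasurable f) {M : ℝ} (hM : ∀ ω, ‖f ω‖ ≤ M) :
    Integrable (fun ω => Real.cosh ‖f ω‖) μ := by
  refine Integrable.of_bound (C := Real.cosh M)
    (Real.continuous_cosh.comp_stronglyMeasurable hf.norm).aestronglyMeasurable
    (ae_of_all _ fun ω => ?_)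
  rw [Real.norm_of_nonneg (Real.cosh_pos _).le, Real.cosh_le_cosh, abs_norm]
  exact (hM ω).trans (le_abs_self M)

omit [InnerProductSpace ℝ E] in
theorem stronglyMeasurable_sum_eval {ι : Type*} [Fintype ι] {ξ : Ω → E}
    (hξ : StronglyMeasurable ξ) : StronglyMeasurable fun ω : ι → Ω => ∑ i, ξ (ω i) :=
  Finset.stronglyMeasurable_fun_sum _ fun i _ => hξ.comp_measurable (measurable_pi_apply i)

variable [CompleteSpace E]

/-- Integrating `cosh_norm_add_le` one variable at a time; the linear term has mean zero. -/
theorem integral_cosh_norm_add_sum_le (μ : Measure Ω) [IsProbabilityMeasure μ] {ξ : Ω → E}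
    (hξ : StronglyMeasurable ξ) {M : ℝ} (hM : ∀ ω, ‖ξ ω‖ ≤ M) (h0 : ∫ ω, ξ ω ∂μ = 0)
    (n : ℕ) (s : E) :
    ∫ ω, Real.cosh ‖s + ∑ i, ξ (ω i)‖ ∂(Measure.pi fun _ : Fin n => μ) ≤
      Real.cosh ‖s‖ * (Real.exp M - M) ^ n := by
  induction n generalizing s with
  | zero => simp
  | succ n ih =>
    have hM0 : 0 ≤ M := by
      obtain ⟨ω⟩ := nonempty_of_isProbabilityMeasure μ
      exact (norm_nonneg _).trans (hM ω)
    have hsum : ∀ {m : ℕ} (ω : Fin m → Ω), ‖∑ i, ξ (ω i)‖ ≤ m * M := fun {m} ω =>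
      (norm_sum_le _ _).trans ((Finset.sum_le_sum fun i _ => hM (ω i)).trans (by simp))
    have hc0 : 0 ≤ Real.exp M - M := by linarith [Real.add_one_le_exp M]
    have hmp := (measurePreserving_piFinSuccAbove (fun _ : Fin (n + 1) => μ) 0).symm
    rw [← hmp.integral_comp']
    have hint : Integrable (fun p : Ω × (Fin n → Ω) =>
        Real.cosh ‖s + ξ p.1 + ∑ i, ξ (p.2 i)‖) (μ.prod (Measure.pi fun _ : Fin n => μ)) := by
      refine integrable_cosh_norm (M := ‖s‖ + M + n * M) ?_ fun p => ?_
      · exact ((hξ.comp_measurable measurable_fst).const_add s).add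
          ((stronglyMeasurable_sum_eval hξ).comp_measurable measurable_snd)
      · exact norm_add_le_of_le (norm_add_le_of_le le_rfl (hM _)) (hsum _)
    have hξi : Integrable ξ μ := .of_bound hξ.aestronglyMeasurable M (ae_of_all _ hM)
    calc _ = ∫ p : Ω × (Fin n → Ω), Real.cosh ‖s + ξ p.1 + ∑ i, ξ (p.2 i)‖
          ∂(μ.prod (Measure.pi fun _ : Fin n => μ)) := by
          refine integral_congr_ae (ae_of_all _ fun p => ?_)
          simp [MeasurableEquiv.piFinSuccAbove, Fin.sum_univ_succ, add_assoc]
      _ = ∫ ω, ∫ ω', Real.cosh ‖s + ξ ω + ∑ i, ξ (ω' i)‖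
          ∂(Measure.pi fun _ : Fin n => μ) ∂μ := integral_prod _ hint
      _ ≤ ∫ ω, (Real.cosh ‖s‖ * (Real.exp M - M) +
            inner ℝ ((Real.sinh ‖s‖ / ‖s‖) • s) (ξ ω)) * (Real.exp M - M) ^ n ∂μ := by
          refine integral_mono hint.integral_prod_left
            (((integrable_const _).add (hξi.const_inner _)).mul_const _) fun ω => ?_
          refine (ih (s + ξ ω)).trans ?_
          gcongr
          refine (cosh_norm_add_le s (ξ ω)).trans ?_
          gcongr Real.cosh ‖s‖ * ?_ + _
          -- `r ↦ exp r - r` is nondecreasing on `[0, ∞)`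
          have h1 := Real.add_one_le_exp (M - ‖ξ ω‖)
          have h2 : Real.exp M = Real.exp ‖ξ ω‖ * Real.exp (M - ‖ξ ω‖) := by
            rw [← Real.exp_add]; ring_nf
          nlinarith [Real.one_le_exp (norm_nonneg (ξ ω)), hM ω]
      _ = Real.cosh ‖s‖ * (Real.exp M - M) ^ (n + 1) := by
          rw [integral_mul_const, integral_add (integrable_const _) (hξi.const_inner _),
            integral_inner hξi, h0]
          simp; ring

/-- Concentration of a sum of `n` independent centred bounded vectors in a Hilbert space: the
exponential moment bound with parameter `1 / (M * √n)`, and Markov's inequality. The tail is only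
exponential, which is enough since a square of the logarithm is allowed in the end. -/
theorem measure_norm_sum_ge_le (μ : Measure Ω) [IsProbabilityMeasure μ] {ξ : Ω → E}
    (hξ : StronglyMeasurable ξ) {M : ℝ} (hM0 : 0 < M) (hM : ∀ ω, ‖ξ ω‖ ≤ M)
    (h0 : ∫ ω, ξ ω ∂μ = 0) {n : ℕ} (hn : 1 ≤ n) {δ : ℝ} (hδ : 0 < δ) :
    (Measure.pi fun _ : Fin n => μ) {ω | M * (1 + Real.log (2 / δ)) * √n ≤ ‖∑ i, ξ (ω i)‖} ≤
      ENNReal.ofReal δ := by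
  have hn0 : (0 : ℝ) < n := by exact_mod_cast hn
  have hsn : 0 < √(n : ℝ) := Real.sqrt_pos.2 hn0
  set t : ℝ := 1 / (M * √n) with ht
  have ht0 : 0 < t := by positivity
  have htM : t * M = 1 / √n := by rw [ht]; field_simp
  have htM1 : t * M ≤ 1 := by
    rw [htM, div_le_one hsn, Real.one_le_sqrt]; exact_mod_cast hn
  have hbd : ∀ ω, ‖t • ξ ω‖ ≤ t * M := fun ω => by
    rw [norm_smul, Real.norm_of_nonneg ht0.le]; gcongr; exact hM ω
  have hmain := integral_cosh_norm_add_sum_le μ (ξ := fun ω => t • ξ ω) (hξ.const_smul t) hbd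
    (by rw [integral_smul, h0, smul_zero]) n 0
  have hexp : (Real.exp (t * M) - t * M) ^ n ≤ Real.exp 1 := by
    have h1 := (abs_le.1 (Real.abs_exp_sub_one_sub_id_le (x := t * M)
      (by rw [abs_of_pos (by positivity)]; exact htM1))).2
    have h2 : Real.exp (t * M) - t * M ≤ Real.exp (1 / n) := by
      have h3 : (t * M) ^ 2 = 1 / n := by rw [htM, div_pow, Real.sq_sqrt hn0.le, one_pow]
      linarith [Real.add_one_le_exp (1 / (n : ℝ))]
    calc _ ≤ Real.exp (1 / n) ^ n := by
          gcongr; linarith [Real.add_one_le_exp (t * M)]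
      _ = Real.exp 1 := by rw [← Real.exp_nat_mul]; congr 1; field_simp
  simp only [norm_zero, Real.cosh_zero, one_mul, zero_add, ← Finset.smul_sum, norm_smul,
    Real.norm_of_nonneg ht0.le] at hmain
  have hint : Integrable (fun ω : Fin n → Ω => Real.cosh (t * ‖∑ i, ξ (ω i)‖))
      (Measure.pi fun _ : Fin n => μ) := by
    have := integrable_cosh_norm (μ := Measure.pi fun _ : Fin n => μ) (M := n * (t * M))
      (f := fun ω : Fin n → Ω => ∑ i, t • ξ (ω i)) (stronglyMeasurable_sum_eval (hξ.const_smul t))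
      fun ω => (norm_sum_le _ _).trans
        ((Finset.sum_le_sum fun i _ => hbd (ω i)).trans (by simp))
    simpa only [← Finset.smul_sum, norm_smul, Real.norm_of_nonneg ht0.le] using this
  have hmk := mul_meas_ge_le_integral_of_nonneg (ae_of_all _ fun ω => (Real.cosh_pos _).le) hint
    (Real.exp 1 / δ)
  have hle := hmk.trans (hmain.trans hexp)
  rw [div_mul_eq_mul_div, div_le_iff₀ hδ] at hle
  have hbad := (ENNReal.le_ofReal_iff_toReal_le (measure_ne_top _ _) hδ.le).2
    (le_of_mul_le_mul_left hle (Real.exp_pos 1))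
  refine (measure_mono fun ω hω => ?_).trans hbad
  have h1 : 1 + Real.log (2 / δ) ≤ t * ‖∑ i, ξ (ω i)‖ := by
    rw [ht, one_div, inv_mul_eq_div, le_div_iff₀ (by positivity)]
    calc _ = M * (1 + Real.log (2 / δ)) * √n := by ring
      _ ≤ _ := hω
  have h2 := Real.exp_le_exp.2 h1
  rw [Real.exp_add, Real.exp_log (by positivity)] at h2
  have h3 := Real.exp_pos (-(t * ‖∑ i, ξ (ω i)‖))
  simp only [Set.mem_ofPred_eq, Real.cosh_eq]
  have : Real.exp 1 / δ = Real.exp 1 * (2 / δ) / 2 := by ring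
  rw [this]
  gcongr
  linarith

end Concentration

/-! ### Kernel ridge regression -/

section Ridge

open scoped TensorProduct

variable {X F : Type*} [NormedAddCommGroup F] [InnerProductSpace ℝ F]

/-- The weights of kernel ridge regression represent the element `u` of the feature space which
solves the normal equation `n * reg * u = ∑ i, (y i - ⟪Φ (x i), u⟫) Φ (x i)`. -/
theorem exists_ridge_solution {k : X → X → ℝ} (hk : IsPosDefKernel k) {Φ : X → F}
    (hΦ : ∀ x x', inner ℝ (Φ x) (Φ x') = k x x') {reg : ℝ} (hreg : 0 < reg) {n : ℕ} (hn : 1 ≤ n)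
    (xs : Fin n → X) (y : Fin n → ℝ) :
    ∃ u : F, (∀ x, ∑ i, ridgeWeights k reg xs x i * y i = inner ℝ (Φ x) u) ∧
      (n * reg) • u = ∑ i, (y i - inner ℝ (Φ (xs i)) u) • Φ (xs i) := by
  have hc : 0 < (n : ℝ) * reg := mul_pos (by exact_mod_cast hn) hreg
  set A : Matrix (Fin n) (Fin n) ℝ :=
    Matrix.of (fun i j => k (xs i) (xs j)) + ((n : ℝ) * reg) • (1 : Matrix (Fin n) (Fin n) ℝ)
    with hA
  have hpd : A.PosDef := Matrix.PosDef.posSemidef_add (hk.submatrix xs) (Matrix.PosDef.one.smul hc)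
  have hsymm : (A⁻¹).transpose = A⁻¹ := by
    have := hpd.isHermitian.inv
    simpa [Matrix.IsHermitian] using this
  set β := A⁻¹.mulVec y with hβ
  have hAβ : A.mulVec β = y := by
    rw [hβ, Matrix.mulVec_mulVec,
      Matrix.mul_nonsing_inv _ ((Matrix.isUnit_iff_isUnit_det _).1 hpd.isUnit), Matrix.one_mulVec]
  have hval : ∀ x, inner ℝ (Φ x) (∑ i, β i • Φ (xs i)) = ∑ i, k x (xs i) * β i := fun x => by
    simp [inner_sum, real_inner_smul_right, hΦ, mul_comm]
  refine ⟨∑ i, β i • Φ (xs i), fun x => ?_, ?_⟩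
  · rw [hval]
    change dotProduct (A⁻¹.mulVec _) y = dotProduct _ β
    rw [hβ, Matrix.dotProduct_mulVec, ← Matrix.mulVec_transpose, hsymm]
  · rw [Finset.smul_sum]
    refine Finset.sum_congr rfl fun i _ => ?_
    rw [smul_smul, hval]
    congr 1
    have := congrFun hAβ i
    simp only [hA, Matrix.add_mulVec, Matrix.smul_mulVec, Matrix.one_mulVec, Pi.add_apply,
      Pi.smul_apply, smul_eq_mul] at this
    rw [← this]
    simp [Matrix.mulVec, dotProduct]

/-- Testing the normal equation against `u - h` bounds at once the norm and the empirical norm of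
the estimation error by the noise and the bias. -/
theorem ridge_energy_bound {ι : Type*} [Fintype ι] {Φ : ι → F} {y : ι → ℝ} {c R : ℝ} {u h : F}
    (hu : c • u = ∑ i, (y i - inner ℝ (Φ i) u) • Φ i)
    (hR : ‖∑ i, (y i - inner ℝ (Φ i) h) • Φ i‖ ≤ R) (hc : 0 ≤ c) :
    c * ‖u - h‖ ^ 2 + ∑ i, inner ℝ (Φ i) (u - h) ^ 2 ≤ (R + c * ‖h‖) * ‖u - h‖ := by
  have hw : c • (u - h) + ∑ i, inner ℝ (Φ i) (u - h) • Φ i =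
      ∑ i, (y i - inner ℝ (Φ i) h) • Φ i - c • h := by
    rw [smul_sub, hu, sub_add_eq_add_sub, ← Finset.sum_add_distrib]
    congr 1
    refine Finset.sum_congr rfl fun i _ => ?_
    rw [← add_smul, inner_sub_right]
    congr 1
    ring
  clear hu
  generalize u - h = w at hw ⊢
  have h1 := congrArg (fun v => inner ℝ v w) hw
  simp only [inner_add_left, sum_inner, real_inner_smul_left, real_inner_self_eq_norm_sq,
    inner_sub_left, ← sq] at h1
  have h2 : ∑ i, (y i - inner ℝ (Φ i) h) * inner ℝ (Φ i) w ≤ R * ‖w‖ := by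
    have := real_inner_le_norm (∑ i, (y i - inner ℝ (Φ i) h) • Φ i) w
    simp only [sum_inner, real_inner_smul_left] at this
    exact this.trans (by gcongr)
  have h3 := neg_le_of_abs_le (abs_real_inner_le_norm h w)
  nlinarith [mul_le_mul_of_nonneg_left h3 hc]

/-- The `L¹` norm is at most the `L²` norm on a probability space. -/
theorem integral_abs_le_of_integral_sq_le {Ω : Type*} [MeasurableSpace Ω] {μ : Measure Ω}
    [IsProbabilityMeasure μ] {f : Ω → ℝ} (hf : Integrable (fun ω => f ω ^ 2) μ)
    {s : ℝ} (hs : 0 < s) (h : ∫ ω, f ω ^ 2 ∂μ ≤ s ^ 2) : ∫ ω, |f ω| ∂μ ≤ s := by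
  calc ∫ ω, |f ω| ∂μ ≤ ∫ ω, (f ω ^ 2 / (2 * s) + s / 2) ∂μ := by
        refine integral_mono_of_nonneg (ae_of_all _ fun _ => abs_nonneg _)
          ((hf.div_const _).add (integrable_const _)) (ae_of_all _ fun ω => ?_)
        have : |f ω| = (s ^ 2 + |f ω| ^ 2 - (s - |f ω|) ^ 2) / (2 * s) := by field_simp; ring
        have e : f ω ^ 2 / (2 * s) + s / 2 = (s ^ 2 + |f ω| ^ 2) / (2 * s) := by
          rw [sq_abs]; field_simp; ring
        simp only
        rw [this, e]
        gcongr
        linarith [sq_nonneg (s - |f ω|)]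
    _ = (∫ ω, f ω ^ 2 ∂μ) / (2 * s) + s / 2 := by
        rw [integral_add (hf.div_const _) (integrable_const _), integral_div]; simp
    _ ≤ s ^ 2 / (2 * s) + s / 2 := by gcongr
    _ = s := by field_simp; ring

/-- Uniform concentration of the empirical second moments `∑ ⟪Φ, w⟫²`: they are linear in
`w ⊗ w`, so it suffices to bound the norm of the centred sum of `Φ ⊗ Φ`. The completion of the tensor
product is used in order that the mean of `Φ ⊗ Φ` exists. -/
theorem measure_le_integral_sq_sub_le {Ω : Type*} [MeasurableSpace Ω] (μ : Measure Ω)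
    [IsProbabilityMeasure μ] {Φ : Ω → F} (hΦ : StronglyMeasurable Φ) {κ : ℝ}
    (hκ : ∀ ω, ‖Φ ω‖ ≤ κ) {n : ℕ} (hn : 1 ≤ n) {δ : ℝ} (hδ : 0 < δ) :
    (Measure.pi fun _ : Fin n => μ) {ω | ¬ ∀ w : F,
      n * ∫ ω, inner ℝ (Φ ω) w ^ 2 ∂μ ≤ ∑ i, inner ℝ (Φ (ω i)) w ^ 2 +
        (2 * κ ^ 2 + 1) * (1 + Real.log (2 / δ)) * √n * ‖w‖ ^ 2} ≤ ENNReal.ofReal δ := by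
  let Ψ : Ω → UniformSpace.Completion (F ⊗[ℝ] F) := fun ω => (Φ ω ⊗ₜ[ℝ] Φ ω : F ⊗[ℝ] F)
  have hΨ : StronglyMeasurable Ψ :=
    (UniformSpace.Completion.continuous_coe _).comp_stronglyMeasurable
      (TensorProduct.continuous_tmul.comp_stronglyMeasurable (hΦ.prodMk hΦ))
  have hΨκ : ∀ ω, ‖Ψ ω‖ ≤ κ ^ 2 := fun ω => by
    simp only [Ψ, UniformSpace.Completion.norm_coe, TensorProduct.norm_tmul, ← sq]
    gcongr
    exact hκ ω
  have hΨi : Integrable Ψ μ := .of_bound hΨ.aestronglyMeasurable _ (ae_of_all _ hΨκ)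
  have hΨw : ∀ ω w, inner ℝ (Ψ ω) ((w ⊗ₜ[ℝ] w : F ⊗[ℝ] F) : UniformSpace.Completion (F ⊗[ℝ] F)) =
      inner ℝ (Φ ω) w ^ 2 := fun ω w => by
    simp [Ψ, UniformSpace.Completion.inner_coe, sq]
  have hm : ‖∫ ω, Ψ ω ∂μ‖ ≤ κ ^ 2 := by
    simpa using norm_integral_le_of_norm_le_const (ae_of_all μ hΨκ)
  refine (measure_mono fun ω hω => ?_).trans
    (measure_norm_sum_ge_le μ (hΨ.sub (stronglyMeasurable_const (b := ∫ ω, Ψ ω ∂μ)))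
      (M := 2 * κ ^ 2 + 1) (by positivity)
      (fun ω => (norm_sub_le _ _).trans (by linarith [hΨκ ω])) ?_ hn hδ)
  · simp only [Set.mem_ofPred_eq]
    by_contra! hlt
    refine hω fun w => ?_
    set W := ((w ⊗ₜ[ℝ] w : F ⊗[ℝ] F) : UniformSpace.Completion (F ⊗[ℝ] F)) with hW
    have hmW : inner ℝ (∫ ω, Ψ ω ∂μ) W = ∫ ω, inner ℝ (Φ ω) w ^ 2 ∂μ := by
      rw [real_inner_comm, ← integral_inner hΨi]
      exact integral_congr_ae (ae_of_all _ fun ω =>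
        (real_inner_comm _ _).trans (hΨw ω w))
    have hS : inner ℝ (∑ i, (Ψ (ω i) - ∫ ω, Ψ ω ∂μ)) W =
        ∑ i, inner ℝ (Φ (ω i)) w ^ 2 - n * ∫ ω, inner ℝ (Φ ω) w ^ 2 ∂μ := by
      rw [sum_inner]
      simp only [inner_sub_left, hmW]
      simp [hW, hΨw]
    have hWn : ‖W‖ = ‖w‖ ^ 2 := by
      rw [hW, UniformSpace.Completion.norm_coe, TensorProduct.norm_tmul, sq]
    have h1 := neg_le_of_abs_le (abs_real_inner_le_norm (∑ i, (Ψ (ω i) - ∫ ω, Ψ ω ∂μ)) W)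
    rw [hS, hWn] at h1
    have h2 := mul_le_mul_of_nonneg_right hlt.le (sq_nonneg ‖w‖)
    simp only [Pi.sub_apply] at h2
    linarith
  · simp [integral_sub hΨi (integrable_const _)]

theorem one_le_log_eight_div {δ : ℝ} (hδ0 : 0 < δ) (hδ1 : δ ≤ 1) : 1 ≤ Real.log (8 / δ) := by
  rw [Real.le_log_iff_exp_le (by positivity), le_div_iff₀ hδ0]
  nlinarith [Real.exp_one_lt_d9, Real.exp_pos 1]

/-- The powers of `n` in play, expressed through `n ^ (-1/4)`; with the penalty
`reg = n ^ (-1/2)` the regularization constant `n * reg` is `√n`. -/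
theorem rpow_neg_quarter_facts {n : ℕ} (hn : 1 ≤ n) :
    0 < (n : ℝ) ^ (-(1 / 4) : ℝ) ∧ n * ((n : ℝ) ^ (-(1 / 4) : ℝ)) ^ 2 = √n ∧
      (n : ℝ) ^ (-(1 / 2) : ℝ) = ((n : ℝ) ^ (-(1 / 4) : ℝ)) ^ 2 := by
  have hn0 : (0 : ℝ) < n := by exact_mod_cast hn
  have h2 : ((n : ℝ) ^ (-(1 / 4) : ℝ)) ^ 2 = (n : ℝ) ^ (-(1 / 2) : ℝ) := by
    rw [← Real.rpow_natCast, ← Real.rpow_mul hn0.le]; norm_num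
  refine ⟨by positivity, ?_, h2.symm⟩
  rw [h2, Real.sqrt_eq_rpow]
  nth_rewrite 1 [← Real.rpow_one (n : ℝ)]
  rw [← Real.rpow_add hn0]; norm_num

/-- From the empirical energy bound to the population `L¹` error. `S` stands for the empirical sum
of `⟪Φ, w⟫²`; the energy bound gives `‖w‖ ≤ a + b` and `S ≤ √n * (a + b) ^ 2`, after which the
covariance deviation is of the same order as `S`. -/
theorem ridge_integral_abs_le {Ω : Type*} [MeasurableSpace Ω] {μ : Measure Ω}
    [IsProbabilityMeasure μ] {Φ : Ω → F} {w : F} {n : ℕ} (hn : 1 ≤ n)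
    (hi : Integrable (fun ω => inner ℝ (Φ ω) w ^ 2) μ) {a b d S : ℝ} (ha : 0 < a) (hb : 0 ≤ b)
    (hd : 0 ≤ d)
    (henergy : √n * ‖w‖ ^ 2 + S ≤ (a * √n + √n * b) * ‖w‖) (hS : 0 ≤ S)
    (hcov : n * ∫ ω, inner ℝ (Φ ω) w ^ 2 ∂μ ≤ S + d * √n * ‖w‖ ^ 2) :
    ∫ ω, |inner ℝ (Φ ω) w| ∂μ ≤ (a + b) * (1 + d) * (n : ℝ) ^ (-(1 / 4) : ℝ) := by
  obtain ⟨hq0, hq2, -⟩ := rpow_neg_quarter_facts hn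
  have hn0 : (0 : ℝ) < n := by exact_mod_cast hn
  have hsn : 0 < √(n : ℝ) := Real.sqrt_pos.2 hn0
  set q := (n : ℝ) ^ (-(1 / 4) : ℝ)
  have hw : ‖w‖ ≤ a + b := by
    by_contra! hlt
    have hw0 : 0 < ‖w‖ := (by positivity : 0 < a + b).trans hlt
    nlinarith [mul_pos (mul_pos hsn hw0) (sub_pos.2 hlt)]
  have hSle : S ≤ √n * (a + b) ^ 2 := by
    have h1 : (a * √n + √n * b) * ‖w‖ ≤ (a * √n + √n * b) * (a + b) := by gcongr
    nlinarith [mul_nonneg hsn.le (sq_nonneg ‖w‖)]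
  refine integral_abs_le_of_integral_sq_le hi (by positivity) ?_
  have h1 : d * √n * ‖w‖ ^ 2 ≤ d * √n * (a + b) ^ 2 := by gcongr
  have h2 : (n : ℝ) * ∫ ω, inner ℝ (Φ ω) w ^ 2 ∂μ ≤ n * (q ^ 2 * ((a + b) ^ 2 * (1 + d))) := by
    rw [← mul_assoc, hq2]; linarith
  refine (le_of_mul_le_mul_left h2 hn0).trans ?_
  have h3 : (1 + d) ≤ (1 + d) ^ 2 := by nlinarith
  calc _ ≤ q ^ 2 * ((a + b) ^ 2 * (1 + d) ^ 2) := by gcongr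
    _ = _ := by ring

/-- High-probability `L¹` error of kernel ridge regression with penalty `n ^ (-1/2)`, for a target
`⟪Φ x, h⟫` in the reproducing kernel Hilbert space and bounded responses `y`. The hypothesis `h0`
says that the residuals, weighted by the features, are centred. -/
theorem exists_measure_ridge_error_le [CompleteSpace F] {Z : Type*} [MeasurableSpace X]
    [MeasurableSpace Z] (τ : Measure (X × Z)) [IsProbabilityMeasure τ] {k : X → X → ℝ}
    (hk : IsPosDefKernel k) {Φ : X → F} (hΦ : ∀ x x', inner ℝ (Φ x) (Φ x') = k x x')
    (hΦm : StronglyMeasurable Φ) {κ : ℝ} (hκ : ∀ x, ‖Φ x‖ ≤ κ) {y : X × Z → ℝ}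
    (hy : StronglyMeasurable y) {M : ℝ} (hM : ∀ p, |y p| ≤ M) {h : F}
    (h0 : ∫ p, (y p - inner ℝ (Φ p.1) h) • Φ p.1 ∂τ = 0) :
    ∃ C : ℝ, 0 ≤ C ∧ ∀ δ : ℝ, 0 < δ → δ < 1 → ∀ n : ℕ, 1 ≤ n →
      Measure.pi (fun _ : Fin n => τ) {D | ¬ (
        Integrable (fun x => inner ℝ (Φ x) h - ∑ i,
          ridgeWeights k ((n : ℝ) ^ (-(1 / 2) : ℝ)) (fun j => (D j).1) x i * y (D i)) τ.fst ∧
        ∫ x, |inner ℝ (Φ x) h - ∑ i,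
          ridgeWeights k ((n : ℝ) ^ (-(1 / 2) : ℝ)) (fun j => (D j).1) x i * y (D i)| ∂τ.fst ≤
        C * Real.log (8 / δ) ^ 2 * (n : ℝ) ^ (-(1 / 4) : ℝ))} ≤ ENNReal.ofReal δ := by
  obtain ⟨p₀⟩ := nonempty_of_isProbabilityMeasure τ
  have hκ0 : 0 ≤ κ := (norm_nonneg _).trans (hκ p₀.1)
  have hM0 : 0 ≤ M := (abs_nonneg _).trans (hM p₀)
  set M₁ : ℝ := (M + κ * ‖h‖) * κ + 1
  set M₂ : ℝ := 2 * κ ^ 2 + 1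
  have hM₁0 : 0 < M₁ := by positivity
  have hM₂0 : 0 < M₂ := by positivity
  refine ⟨(2 * M₁ + ‖h‖) * (1 + 2 * M₂), by positivity, fun δ hδ0 hδ1 n hn => ?_⟩
  obtain ⟨hq0, hq2, hreg⟩ := rpow_neg_quarter_facts hn
  have hn0 : (0 : ℝ) < n := by exact_mod_cast hn
  have hl := one_le_log_eight_div hδ0 hδ1.le
  set ℓ := Real.log (8 / δ)
  have hl4 : 1 + Real.log (2 / (δ / 2)) ≤ 2 * ℓ := by
    have : Real.log (2 / (δ / 2)) ≤ ℓ := by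
      refine Real.log_le_log (by positivity) ?_
      rw [div_div_eq_mul_div]; gcongr; norm_num
    linarith
  -- Two concentration events, of probability at least `1 - δ / 2` each: the noise `∑ ξ`, and the
  -- empirical second moments of the feature map.
  let ξ : X × Z → F := fun p => (y p - inner ℝ (Φ p.1) h) • Φ p.1
  have hΦ1 : StronglyMeasurable fun p : X × Z => Φ p.1 := hΦm.comp_measurable measurable_fst
  have hξ : StronglyMeasurable ξ := (hy.sub (hΦ1.inner stronglyMeasurable_const)).smul hΦ1
  have hξM : ∀ p, ‖ξ p‖ ≤ M₁ := fun p => by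
    have h1 : |inner ℝ (Φ p.1) h| ≤ κ * ‖h‖ :=
      (abs_real_inner_le_norm _ _).trans (by gcongr; exact hκ _)
    have h2 : |y p - inner ℝ (Φ p.1) h| ≤ M + κ * ‖h‖ := (abs_sub _ _).trans (add_le_add (hM p) h1)
    rw [norm_smul, Real.norm_eq_abs]
    have := mul_le_mul h2 (hκ p.1) (norm_nonneg _) (by positivity)
    linarith
  have hB₁ := measure_norm_sum_ge_le τ hξ hM₁0 hξM h0 hn (half_pos hδ0)
  have hB₂ := measure_le_integral_sq_sub_le τ hΦ1 (fun p => hκ p.1) hn (half_pos hδ0)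
  have hsum := (measure_union_le _ _).trans (add_le_add hB₁ hB₂)
  rw [← ENNReal.ofReal_add (by positivity) (by positivity), add_halves] at hsum
  refine (measure_mono fun D hD => ?_).trans hsum
  by_contra hnot
  simp only [Set.mem_union, Set.mem_ofPred_eq, not_or, not_not, not_le] at hnot hD
  obtain ⟨h1, h2⟩ := hnot
  obtain ⟨u, hval, hu⟩ := exists_ridge_solution hk hΦ
    (reg := (n : ℝ) ^ (-(1 / 2) : ℝ)) (by positivity) hn
    (fun j => (D j).1) (fun j => y (D j))
  refine hD ?_
  rw [hreg, hq2] at hu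
  have h1' : ‖∑ i, ξ (D i)‖ ≤ 2 * M₁ * ℓ * √n := by
    refine h1.le.trans ?_
    calc M₁ * (1 + Real.log (2 / (δ / 2))) * √n ≤ M₁ * (2 * ℓ) * √n := by gcongr
      _ = _ := by ring
  have henergy := ridge_energy_bound hu h1' (Real.sqrt_nonneg _)
  have hcov := h2 (u - h)
  have hM₂ℓ : M₂ * (1 + Real.log (2 / (δ / 2))) ≤ 2 * M₂ * ℓ := by
    calc M₂ * (1 + Real.log (2 / (δ / 2))) ≤ M₂ * (2 * ℓ) := by gcongr
      _ = _ := by ring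
  have hfst : ∀ f : X → ℝ, StronglyMeasurable f → ∫ p, f p.1 ∂τ = ∫ x, f x ∂τ.fst := fun f hf =>
    (integral_map measurable_fst.aemeasurable hf.aestronglyMeasurable).symm
  have hm : StronglyMeasurable fun x => inner ℝ (Φ x) (u - h) := hΦm.inner stronglyMeasurable_const
  rw [hfst (fun x => inner ℝ (Φ x) (u - h) ^ 2) (hm.pow 2)] at hcov
  have hi : Integrable (fun x => inner ℝ (Φ x) (u - h) ^ 2) τ.fst := by
    refine .of_bound (hm.pow 2).aestronglyMeasurable ((κ * ‖u - h‖) ^ 2) (ae_of_all _ fun x => ?_)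
    rw [norm_pow]
    gcongr
    exact (norm_inner_le_norm _ _).trans (by gcongr; exact hκ _)
  have hfinal := ridge_integral_abs_le (b := ‖h‖) (d := 2 * M₂ * ℓ) hn hi
    (by positivity : 0 < 2 * M₁ * ℓ) (norm_nonneg _) (by positivity) henergy
    (Finset.sum_nonneg fun i _ => sq_nonneg _) (hcov.trans (by gcongr))
  have e : ∀ x, inner ℝ (Φ x) h - ∑ i, ridgeWeights k ((n : ℝ) ^ (-(1 / 2) : ℝ))
      (fun j => (D j).1) x i * y (D i) = -inner ℝ (Φ x) (u - h) := fun x => by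
    rw [hval, inner_sub_right, neg_sub]
  simp only [e, abs_neg]
  refine ⟨.of_bound hm.neg.aestronglyMeasurable (κ * ‖u - h‖) (ae_of_all _ fun x => ?_),
    hfinal.trans ?_⟩
  · rw [norm_neg]
    exact (norm_inner_le_norm _ _).trans (by gcongr; exact hκ _)
  refine mul_le_mul_of_nonneg_right ?_ hq0.le
  calc (2 * M₁ * ℓ + ‖h‖) * (1 + 2 * M₂ * ℓ) ≤ (2 * M₁ * ℓ + ‖h‖ * ℓ) * (1 * ℓ + 2 * M₂ * ℓ) := by
        gcongr
        · exact le_mul_of_one_le_right (norm_nonneg _) hl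
        · linarith
    _ = _ := by ring

end Ridge

/-! ### Feature maps of the kernel -/

section FeatureMap

universe u v

/-- The coordinate `⟪w, G x⟫` of an element of the `H`-valued reproducing kernel Hilbert space is
an inner product with a feature map of the scalar kernel `k`: take the kernel sections of the
`H`-valued space in the direction `w / ‖w‖`, so that no scalar space has to be compared with it. -/
theorem MemRKHS.exists_featureMap {X : Type u} {H : Type v} [NormedAddCommGroup H]
    [InnerProductSpace ℝ H] [CompleteSpace H] {k : X → X → ℝ} (hk : IsPosDefKernel k)
    {G : X → H} (hG : MemRKHS k G)
    {w : H} (hw : w ≠ 0) :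
    ∃ (F : Type (max u v)) (_ : NormedAddCommGroup F) (_ : InnerProductSpace ℝ F)
      (_ : CompleteSpace F) (Φ : X → F) (h : F),
      (∀ x x', inner ℝ (Φ x) (Φ x') = k x x') ∧ ∀ x, inner ℝ (Φ x) h = inner ℝ w (G x) := by
  obtain ⟨hp, hG⟩ := hG
  have : Fact (opKernel k H).PosSemidef := ⟨hp⟩
  obtain ⟨g, hg⟩ := hG
  have hw' := norm_ne_zero_iff.2 hw
  refine ⟨RKHS.OfKernel (opKernel k H), inferInstance, inferInstance, inferInstance,
    fun x => RKHS.kerFun (RKHS.OfKernel (opKernel k H)) x (‖w‖⁻¹ • w), ‖w‖ • g, fun x x' => ?_,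
    fun x => ?_⟩
  · have hsymm : k x' x = k x x' := by simpa using hk.1.apply x x'
    rw [← RKHS.kernel_inner, RKHS.OfKernel.kernel_ofKernel]
    simp [opKernel, real_inner_smul_left, real_inner_smul_right, hsymm]
    field_simp
  · rw [RKHS.kerFun_inner, RKHS.coe_smul, Pi.smul_apply, hg, real_inner_smul_left,
      real_inner_smul_right]
    field_simp

theorem continuous_of_continuous_inner {X F : Type*} [TopologicalSpace X] [NormedAddCommGroup F]
    [InnerProductSpace ℝ F] {Φ : X → F}
    (h : Continuous fun p : X × X => inner ℝ (Φ p.1) (Φ p.2)) : Continuous Φ := by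
  refine continuous_iff_continuousAt.2 fun x₀ => tendsto_iff_norm_sub_tendsto_zero.2 ?_
  have h1 : Continuous fun x => √(inner ℝ (Φ x) (Φ x) - 2 * inner ℝ (Φ x) (Φ x₀) +
      inner ℝ (Φ x₀) (Φ x₀)) := by
    have ha : Continuous fun x => inner ℝ (Φ x) (Φ x) := h.comp (continuous_id.prodMk continuous_id)
    have hb : Continuous fun x => inner ℝ (Φ x) (Φ x₀) :=
      h.comp (continuous_id.prodMk continuous_const)
    fun_prop
  have h2 := h1.tendsto x₀
  rw [show inner ℝ (Φ x₀) (Φ x₀) - 2 * inner ℝ (Φ x₀) (Φ x₀) + inner ℝ (Φ x₀) (Φ x₀) = (0 : ℝ) by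
    ring, Real.sqrt_zero] at h2
  refine h2.congr fun x => ?_
  rw [real_inner_self_eq_norm_sq, real_inner_self_eq_norm_sq, ← norm_sub_sq_real,
    Real.sqrt_sq (norm_nonneg _)]

end FeatureMap

/-! ### Non-ambiguity, minimum variability and calibration -/

section Labels

variable {X Y : Type*} [MeasurableSpace X]

theorem infLoss_nonneg {loss : Y → Y → ℝ} (hloss : IsProperLoss loss) (z : Y) (S : Set Y) :
    0 ≤ infLoss loss z S :=
  Real.sInf_nonneg (by rintro _ ⟨y, -, rfl⟩; exact (hloss z y).1)

theorem infLoss_eq_zero {loss : Y → Y → ℝ} (hloss : IsProperLoss loss) {z : Y} {S : Set Y}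
    (hz : z ∈ S) : infLoss loss z S = 0 := by
  refine le_antisymm ?_ (infLoss_nonneg hloss z S)
  exact csInf_le ⟨0, by rintro _ ⟨y, -, rfl⟩; exact (hloss z y).1⟩
    ⟨z, hz, (hloss z z).2.2 rfl⟩

theorem measurable_commonLabels [Finite Y] {κ : ProbabilityTheory.Kernel X (Set Y)} :
    Measurable fun x => commonLabels (κ x) := by
  refine measurable_set_iff.2 fun y => ?_
  have : ∀ x, y ∈ commonLabels (κ x) ↔ ∀ S : Set Y, κ x {S} ≠ 0 → y ∈ S := fun x => by
    simp [commonLabels]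
  simp only [this]
  refine Measurable.forall fun S => Measurable.imp ?_ measurable_const
  exact (measurableSet_eq_fun (κ.measurable_coe (measurableSet_singleton S))
    measurable_const).compl.mem

theorem ae_mem_of_mem_commonLabels [Finite Y] {μ : Measure (Set Y)} {y : Y}
    (hy : y ∈ commonLabels μ) : ∀ᵐ S ∂μ, y ∈ S := by
  rw [ae_iff_of_countable]
  exact fun S hS => Set.mem_iInter₂.1 hy S hS

/-- Calibration: if `y` is the only common label and every other label is missed with probability
at least `η`, then the infimum risk of `z` controls `loss z y`. Indeed a set missing `z` but
containing `y` costs at least the least positive value of the loss. -/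
theorem exists_loss_le_mul_integral_infLoss [Finite Y] {loss : Y → Y → ℝ} (hloss : IsProperLoss loss)
    {η : ℝ} (hη : 0 < η) :
    ∃ C : ℝ, 0 ≤ C ∧ ∀ (μ : Measure (Set Y)) [IsProbabilityMeasure μ] (y : Y),
      commonLabels μ = {y} → (∀ z, z ∉ commonLabels μ → μ.real {S | z ∈ S} ≤ 1 - η) →
      ∀ z, loss z y ≤ C * ∫ S, infLoss loss z S ∂μ := by
  obtain ⟨B, hB⟩ := (Set.finite_range fun q : Y × Y => loss q.1 q.2).bddAbove
  obtain ⟨c, hc0, hc⟩ : ∃ c : ℝ, 0 < c ∧ ∀ z y, z ≠ y → c ≤ loss z y := by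
    rcases isEmpty_or_nonempty {q : Y × Y // q.1 ≠ q.2} with he | he
    · exact ⟨1, one_pos, fun z y h => (he.false ⟨(z, y), h⟩).elim⟩
    · obtain ⟨q, hq⟩ := Finite.exists_min fun q : {q : Y × Y // q.1 ≠ q.2} => loss q.1.1 q.1.2
      refine ⟨loss q.1.1 q.1.2, lt_of_le_of_ne (hloss _ _).1 fun h => q.2 ?_,
        fun z y h => hq ⟨(z, y), h⟩⟩
      exact (hloss _ _).2.1 h.symm
  refine ⟨max B 0 / (c * η), by positivity, fun μ _ y hy hμ z => ?_⟩
  have hint0 : 0 ≤ ∫ S, infLoss loss z S ∂μ := integral_nonneg fun S => infLoss_nonneg hloss z S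
  rcases eq_or_ne z y with rfl | hz
  · rw [(hloss z z).2.2 rfl]; positivity
  have hyS : ∀ᵐ S ∂μ, y ∈ S := ae_mem_of_mem_commonLabels (hy ▸ rfl)
  have hreal : η ≤ μ.real {S | z ∈ S}ᶜ := by
    rw [probReal_compl_eq_one_sub MeasurableSet.of_discrete]
    linarith [hμ z (by rw [hy]; exact hz)]
  have hlow : c * η ≤ ∫ S, infLoss loss z S ∂μ := by
    calc c * η ≤ c * μ.real {S | z ∈ S}ᶜ := by gcongr
      _ = ∫ S, ({S | z ∈ S}ᶜ : Set (Set Y)).indicator (fun _ => c) S ∂μ := by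
          rw [integral_indicator_const _ MeasurableSet.of_discrete, smul_eq_mul, mul_comm]
      _ ≤ ∫ S, infLoss loss z S ∂μ := by
          refine integral_mono_ae .of_finite .of_finite ?_
          filter_upwards [hyS] with S hS
          by_cases hzS : z ∈ S
          · simpa [hzS] using infLoss_nonneg hloss z S
          · simp only [Set.indicator, Set.mem_compl_iff, Set.mem_ofPred_eq, hzS, not_false_eq_true,
              if_true]
            refine le_csInf (Set.Nonempty.image _ ⟨y, hS⟩) ?_
            rintro _ ⟨y', hy', rfl⟩
            exact hc z y' fun h => hzS (h ▸ hy')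
  calc loss z y ≤ max B 0 := (hB ⟨(z, y), rfl⟩).trans (le_max_left _ _)
    _ = max B 0 / (c * η) * (c * η) := by field_simp
    _ ≤ _ := by gcongr

variable [MeasurableSpace Y]

theorem risk_nonneg {loss : Y → Y → ℝ} (hloss : IsProperLoss loss) (ρ : Measure (X × Y))
    (f : X → Y) : 0 ≤ risk loss ρ f :=
  integral_nonneg fun _ => (hloss _ _).1

theorem Eligible.fst_eq {ρ : Measure (X × Y)} {τ : Measure (X × Set Y)} (h : Eligible ρ τ) :
    ρ.fst = τ.fst := by
  obtain ⟨π, -, rfl, rfl, -⟩ := h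
  rw [Measure.fst, Measure.fst, Measure.map_map measurable_fst (by fun_prop),
    Measure.map_map measurable_fst (by fun_prop)]
  rfl

variable [Finite Y] [MeasurableSingletonClass Y]

/-- A measurable choice of labels is almost surely compatible with the observed set if and only if
it almost surely belongs to every set in the support of the conditional distribution. -/
theorem ae_forall_mem_iff {τ : Measure (X × Set Y)} [IsFiniteMeasure τ] {f : X → Y}
    (hf : Measurable f) :
    (∀ᵐ p ∂τ, f p.1 ∈ p.2) ↔ ∀ᵐ x ∂τ.fst, f x ∈ commonLabels (τ.condKernel x) := by
  have hms : MeasurableSet {p : X × Set Y | f p.1 ∈ p.2} :=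
    ((hf.comp measurable_fst).prodMk measurable_snd)
      (MeasurableSet.of_discrete (s := {q : Y × Set Y | q.1 ∈ q.2}))
  nth_rewrite 1 [← τ.disintegrate τ.condKernel]
  rw [Measure.ae_compProd_iff hms]
  refine Filter.eventually_congr (ae_of_all _ fun x => ?_)
  rw [ae_iff_of_countable]
  simp [commonLabels]

/-- Under non-ambiguity, attaching to each input a common label of its sets gives an eligible
deterministic distribution, whose variability vanishes. -/
theorem exists_eligible_variability_nonpos [Nonempty Y] {loss : Y → Y → ℝ}
    (hloss : IsProperLoss loss) {τ : Measure (X × Set Y)} [IsProbabilityMeasure τ]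
    (hτ : NonAmbiguous τ) :
    ∃ ρ : Measure (X × Y), IsProbabilityMeasure ρ ∧ Eligible ρ τ ∧ variability loss ρ ≤ 0 := by
  let f : X → Y := fun x => Classical.epsilon (· ∈ commonLabels (τ.condKernel x))
  have hf : Measurable f :=
    (Measurable.of_discrete (f := fun C : Set Y => Classical.epsilon (· ∈ C))).comp
      measurable_commonLabels
  have hmem : ∀ᵐ p ∂τ, f p.1 ∈ p.2 := by
    rw [ae_forall_mem_iff hf]
    filter_upwards [hτ] with x ⟨y, hy⟩
    exact Classical.epsilon_spec (p := (· ∈ commonLabels (τ.condKernel x))) ⟨y, hy ▸ rfl⟩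
  have hf1 : Measurable fun p : X × Set Y => f p.1 := hf.comp measurable_fst
  have hρm : Measurable fun p : X × Set Y => (p.1, f p.1) := measurable_fst.prodMk hf1
  have hπm : Measurable fun p : X × Set Y => (p.1, f p.1, p.2) :=
    measurable_fst.prodMk (hf1.prodMk measurable_snd)
  refine ⟨τ.map fun p => (p.1, f p.1), Measure.isProbabilityMeasure_map hρm.aemeasurable,
    ⟨τ.map fun p => (p.1, f p.1, p.2), Measure.isProbabilityMeasure_map hπm.aemeasurable,
      ?_, ?_, ?_⟩, ?_⟩
  · rw [Measure.map_map (by fun_prop) hπm]; rfl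
  · rw [Measure.map_map (by fun_prop) hπm]; exact Measure.map_id
  · have hms : MeasurableSet {p : X × Y × Set Y | p.2.1 ∉ p.2.2} :=
      measurable_snd (MeasurableSet.of_discrete (s := {q : Y × Set Y | q.1 ∉ q.2}))
    rw [Measure.map_apply hπm hms]
    exact hmem
  · refine (ciInf_le ⟨0, ?_⟩ ⟨f, hf⟩).trans_eq ?_
    · rintro _ ⟨g, rfl⟩
      exact risk_nonneg hloss _ _
    · rw [risk, integral_map hρm.aemeasurable]
      · simp [fun z => (hloss z z).2.2 rfl]
      · have h : Measurable fun p : X × Y => loss (f p.1) p.2 :=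
          (Measurable.of_discrete (f := fun q : Y × Y => loss q.1 q.2)).comp
            ((hf.comp measurable_fst).prodMk measurable_snd)
        exact h.aestronglyMeasurable

theorem integrable_loss {Ω : Type*} [MeasurableSpace Ω] (loss : Y → Y → ℝ) {μ : Measure Ω}
    [IsFiniteMeasure μ] {f g : Ω → Y} (hf : Measurable f) (hg : Measurable g) :
    Integrable (fun ω => loss (f ω) (g ω)) μ := by
  have h : Measurable fun ω => loss (f ω) (g ω) :=
    (Measurable.of_discrete (f := fun q : Y × Y => loss q.1 q.2)).comp (hf.prodMk hg)
  obtain ⟨B, hB⟩ := (Set.finite_range fun q : Y × Y => ‖loss q.1 q.2‖).bddAbove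
  exact .of_bound h.aestronglyMeasurable B
    (ae_of_all _ fun ω => hB ⟨(f ω, g ω), rfl⟩)

/-- The minimum variability is zero under non-ambiguity, so the optimal predictor recovers the
label almost surely. -/
theorem IsMinVariability.ae_eq_of_isRiskMinimizer {loss : Y → Y → ℝ}
    (hloss : IsProperLoss loss) {τ : Measure (X × Set Y)} [IsProbabilityMeasure τ]
    (hτ : NonAmbiguous τ) {ρ : Measure (X × Y)} (hρ : IsMinVariability loss τ ρ) {f : X → Y}
    (hf : IsRiskMinimizer loss ρ f) :
    ∀ᵐ p ∂ρ, f p.1 = p.2 := by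
  obtain ⟨hρp, -, hmin⟩ := hρ
  have : Nonempty Y := (nonempty_of_isProbabilityMeasure ρ).map Prod.snd
  obtain ⟨ρ', hp', he', hv'⟩ := exists_eligible_variability_nonpos hloss hτ
  have hle : risk loss ρ f ≤ variability loss ρ := by
    have : Nonempty {f : X → Y // Measurable f} := ⟨⟨f, hf.1⟩⟩
    exact le_ciInf fun g => hf.2 g.1 g.2
  have h0 : risk loss ρ f = 0 :=
    le_antisymm (hle.trans ((hmin ρ' hp' he').trans hv')) (risk_nonneg hloss _ _)
  have := (integral_eq_zero_iff_of_nonneg (fun p => (hloss _ _).1)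
    (integrable_loss loss (hf.1.comp measurable_fst) measurable_snd)).1 h0
  filter_upwards [this] with p hp
  exact (hloss _ _).2.1 hp

theorem Eligible.ae_mem {ρ : Measure (X × Y)} {τ : Measure (X × Set Y)} (h : Eligible ρ τ)
    {f : X → Y} (hf : Measurable f) (hρ : ∀ᵐ p ∂ρ, f p.1 = p.2) : ∀ᵐ p ∂τ, f p.1 ∈ p.2 := by
  obtain ⟨π, -, rfl, rfl, hπ⟩ := h
  have hms : MeasurableSet {p : X × Set Y | f p.1 ∈ p.2} :=
    ((hf.comp measurable_fst).prodMk measurable_snd)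
      (MeasurableSet.of_discrete (s := {q : Y × Set Y | q.1 ∈ q.2}))
  rw [ae_map_iff (by fun_prop) hms]
  have hπ' : ∀ᵐ p ∂π, p.2.1 ∈ p.2.2 := hπ
  filter_upwards [ae_of_ae_map (by fun_prop) hρ, hπ'] with p h1 h2
  exact h1 ▸ h2

end Labels

/-! ### Estimation of the conditional infimum risks -/

section Estimation

/-- Kernel ridge regression with penalty `n ^ (-1/2)` estimates a conditional mean
`E[L(S) | X = x]` lying in the reproducing kernel Hilbert space at the `L¹` rate `n ^ (-1/4)`. The
residuals are centred by disintegration of `τ`. Integrability of the error is part of the good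
event, so that the bound on its integral is meaningful. -/
theorem exists_measure_ridge_condMean_error_le {X F Z : Type*} [TopologicalSpace X]
    [SecondCountableTopology X] [MeasurableSpace X] [OpensMeasurableSpace X]
    [NormedAddCommGroup F] [InnerProductSpace ℝ F] [CompleteSpace F]
    [MeasurableSpace Z] [StandardBorelSpace Z] [Nonempty Z]
    (τ : Measure (X × Z)) [IsProbabilityMeasure τ] {k : X → X → ℝ} (hk : IsPosDefKernel k)
    (hkcont : Continuous fun p : X × X => k p.1 p.2) (hkbdd : ∃ B : ℝ, ∀ x y, |k x y| ≤ B)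
    {Φ : X → F} (hΦ : ∀ x x', inner ℝ (Φ x) (Φ x') = k x x') {L : Z → ℝ}
    (hL : Measurable L) {M : ℝ} (hM : ∀ S, |L S| ≤ M) {h : F}
    (hh : ∀ᵐ x ∂τ.fst, inner ℝ (Φ x) h = ∫ S, L S ∂τ.condKernel x) :
    ∃ C : ℝ, 0 ≤ C ∧ ∀ δ : ℝ, 0 < δ → δ < 1 → ∀ n : ℕ, 1 ≤ n →
      Measure.pi (fun _ : Fin n => τ) {D | ¬ (
        Integrable (fun x => ∫ S, L S ∂τ.condKernel x - ∑ i,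
          ridgeWeights k ((n : ℝ) ^ (-(1 / 2) : ℝ)) (fun j => (D j).1) x i * L (D i).2) τ.fst ∧
        ∫ x, |∫ S, L S ∂τ.condKernel x - ∑ i,
          ridgeWeights k ((n : ℝ) ^ (-(1 / 2) : ℝ)) (fun j => (D j).1) x i * L (D i).2| ∂τ.fst ≤
        C * Real.log (8 / δ) ^ 2 * (n : ℝ) ^ (-(1 / 4) : ℝ))} ≤ ENNReal.ofReal δ := by
  have hΦm : StronglyMeasurable Φ :=
    (continuous_of_continuous_inner (by simpa only [hΦ] using hkcont)).stronglyMeasurable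
  obtain ⟨B, hB⟩ := hkbdd
  have hκ : ∀ x, ‖Φ x‖ ≤ √B := fun x => by
    refine Real.le_sqrt_of_sq_le ?_
    rw [← real_inner_self_eq_norm_sq, hΦ]
    exact (le_abs_self _).trans (hB x x)
  have hΦ1 : StronglyMeasurable fun p : X × Z => Φ p.1 := hΦm.comp_measurable measurable_fst
  have hy : StronglyMeasurable fun p : X × Z => L p.2 := (hL.comp measurable_snd).stronglyMeasurable
  have h0 : ∫ p, (L p.2 - inner ℝ (Φ p.1) h) • Φ p.1 ∂τ = 0 := by
    have hi : Integrable (fun p : X × Z => (L p.2 - inner ℝ (Φ p.1) h) • Φ p.1) τ := by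
      refine .of_bound ((hy.sub (hΦ1.inner stronglyMeasurable_const)).smul hΦ1).aestronglyMeasurable
        ((M + √B * ‖h‖) * √B) (ae_of_all _ fun p => ?_)
      have h1 : |inner ℝ (Φ p.1) h| ≤ √B * ‖h‖ :=
        (abs_real_inner_le_norm _ _).trans (by gcongr; exact hκ _)
      rw [norm_smul, Real.norm_eq_abs]
      have h2 := (abs_sub _ _).trans (add_le_add (hM p.2) h1)
      exact mul_le_mul h2 (hκ p.1) (norm_nonneg _) ((abs_nonneg _).trans h2)
    rw [← τ.disintegrate τ.condKernel] at hi ⊢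
    rw [Measure.integral_compProd hi]
    refine integral_eq_zero_of_ae ?_
    filter_upwards [hh] with x hx
    have hLi : Integrable L (τ.condKernel x) := .of_bound hL.aestronglyMeasurable M (ae_of_all _ hM)
    simp only [Pi.zero_apply]
    rw [integral_smul_const, integral_sub hLi (integrable_const _), ← hx]
    simp
  obtain ⟨C, hC0, hC⟩ := exists_measure_ridge_error_le τ hk hΦ hΦm hκ hy (fun p => hM p.2) h0
  refine ⟨C, hC0, fun δ hδ0 hδ1 n hn => (measure_mono fun D hD => ?_).trans (hC δ hδ0 hδ1 n hn)⟩
  simp only [Set.mem_ofPred_eq] at hD ⊢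
  contrapose! hD
  refine ⟨hD.1.congr ?_, (integral_congr_ae ?_).trans_le hD.2⟩
  · filter_upwards [hh] with x hx using by rw [hx]
  · filter_upwards [hh] with x hx using by rw [hx]

/-- The scalar regression problem in the direction `w`: if the vector-valued conditional mean of
`φ` lies in the vector-valued reproducing kernel Hilbert space, then `⟪w, φ S⟫` is regressed at the
rate `n ^ (-1/4)`. Only almost sure equality of `L S` and `⟪w, φ S⟫` is required, because the
decomposition of the infimum loss says nothing about the empty set. -/
theorem exists_measure_infLoss_error_le {X Y H : Type*} [TopologicalSpace X] [PolishSpace X]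
    [MeasurableSpace X] [BorelSpace X] [Finite Y]
    [NormedAddCommGroup H] [InnerProductSpace ℝ H] [CompleteSpace H]
    (τ : Measure (X × Set Y)) [IsProbabilityMeasure τ] {k : X → X → ℝ} (hk : IsPosDefKernel k)
    (hkcont : Continuous fun p : X × X => k p.1 p.2) (hkbdd : ∃ B : ℝ, ∀ x y, |k x y| ≤ B)
    {φ : Set Y → H} {G : X → H} (hG : MemRKHS k G)
    (hGφ : ∀ᵐ x ∂τ.fst, ∫ S, φ S ∂τ.condKernel x = G x) {L : Set Y → ℝ} (w : H)
    (hL : ∀ᵐ x ∂τ.fst, ∀ᵐ S ∂τ.condKernel x, L S = inner ℝ w (φ S)) :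
    ∃ C : ℝ, 0 ≤ C ∧ ∀ δ : ℝ, 0 < δ → δ < 1 → ∀ n : ℕ, 1 ≤ n →
      Measure.pi (fun _ : Fin n => τ) {D | ¬ (
        Integrable (fun x => ∫ S, L S ∂τ.condKernel x - ∑ i,
          ridgeWeights k ((n : ℝ) ^ (-(1 / 2) : ℝ)) (fun j => (D j).1) x i * L (D i).2) τ.fst ∧
        ∫ x, |∫ S, L S ∂τ.condKernel x - ∑ i,
          ridgeWeights k ((n : ℝ) ^ (-(1 / 2) : ℝ)) (fun j => (D j).1) x i * L (D i).2| ∂τ.fst ≤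
        C * Real.log (8 / δ) ^ 2 * (n : ℝ) ^ (-(1 / 4) : ℝ))} ≤ ENNReal.ofReal δ := by
  obtain ⟨M, hM⟩ := (Set.finite_range fun S => |L S|).bddAbove
  have hM' : ∀ S, |L S| ≤ M := fun S => hM ⟨S, rfl⟩
  have hmean : ∀ᵐ x ∂τ.fst, inner ℝ w (G x) = ∫ S, L S ∂τ.condKernel x := by
    filter_upwards [hL, hGφ] with x h1 h2
    rw [← h2, ← integral_inner .of_finite]
    exact (integral_congr_ae h1).symm
  rcases eq_or_ne w 0 with rfl | hw
  · -- No multiple of `w` is a unit vector, but the target vanishes almost everywhere, and zero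
    -- belongs to the scalar reproducing kernel Hilbert space of `k`.
    obtain ⟨F, _, _, _, Φ, -, hΦ, -⟩ := MemRKHS.exists_featureMap (H := ℝ) hk (G := fun _ => 0)
      ⟨opKernel_posSemidef hk, 0, fun x => by rw [RKHS.coe_zero]; rfl⟩ one_ne_zero
    refine exists_measure_ridge_condMean_error_le τ hk hkcont hkbdd hΦ .of_discrete hM' (h := 0) ?_
    filter_upwards [hmean] with x hx
    rw [← hx, inner_zero_left, inner_zero_right]
  · obtain ⟨F, _, _, _, Φ, h, hΦ, hh⟩ := hG.exists_featureMap hk hw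
    refine exists_measure_ridge_condMean_error_le τ hk hkcont hkbdd hΦ .of_discrete hM' (h := h) ?_
    filter_upwards [hmean] with x hx
    rw [hh, hx]

end Estimation

/-! ### Union bound and comparison inequality -/

/-- The cost of a union bound over `N` events: it only multiplies `log (8 / δ)` by a constant. -/
theorem log_eight_mul_div_le {N δ : ℝ} (hN : 1 ≤ N) (hδ0 : 0 < δ) (hδ1 : δ ≤ 1) :
    Real.log (8 / (δ / N)) ≤ (1 + Real.log N) * Real.log (8 / δ) := by
  have hl := one_le_log_eight_div hδ0 hδ1
  rw [div_div_eq_mul_div, mul_div_right_comm, Real.log_mul (by positivity) (by positivity)]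
  nlinarith [Real.log_nonneg hN]

/-- Union bound. The good event is the complement of a measurable hull, so the bad events need not
be measurable. -/
theorem exists_measurableSet_forall_of_measure_le {Ω ι : Type*} [MeasurableSpace Ω] [Fintype ι]
    [Nonempty ι] (μ : Measure Ω) [IsProbabilityMeasure μ] {p : ι → Ω → Prop} {δ : ℝ} (hδ : 0 < δ)
    (hp : ∀ i, μ {ω | ¬ p i ω} ≤ ENNReal.ofReal (δ / Fintype.card ι)) :
    ∃ A, MeasurableSet A ∧ ENNReal.ofReal (1 - δ) ≤ μ A ∧ ∀ ω ∈ A, ∀ i, p i ω := by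
  refine ⟨(toMeasurable μ (⋃ i, {ω | ¬ p i ω}))ᶜ, (measurableSet_toMeasurable _ _).compl, ?_,
    fun ω hω i => ?_⟩
  · rw [prob_compl_eq_one_sub (measurableSet_toMeasurable _ _), measure_toMeasurable,
      ENNReal.ofReal_sub _ hδ.le, ENNReal.ofReal_one]
    refine tsub_le_tsub_left ((measure_iUnion_fintype_le μ _).trans
      ((Finset.sum_le_sum fun i _ => hp i).trans_eq ?_)) _
    rw [Finset.sum_const, Finset.card_univ, nsmul_eq_mul, ← ENNReal.ofReal_natCast,
      ← ENNReal.ofReal_mul (by positivity), mul_div_cancel₀ _ (by positivity)]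
  · by_contra hni
    exact hω (subset_toMeasurable _ _ (Set.mem_iUnion.2 ⟨i, hni⟩))

/-- If `b` prefers `i` to `j`, then `a` prefers `j` to `i` by at most twice the distance between
`a` and `b`: the comparison inequality of plug-in rules. -/
theorem sub_le_two_mul_sum_abs_sub {ι : Type*} [Fintype ι] {a b : ι → ℝ} {i j : ι}
    (h : b i ≤ b j) : a i - a j ≤ 2 * ∑ z, |a z - b z| := by
  have h1 := Finset.single_le_sum (f := fun z => |a z - b z|) (fun _ _ => abs_nonneg _)
    (Finset.mem_univ i)
  have h2 := Finset.single_le_sum (f := fun z => |a z - b z|) (fun _ _ => abs_nonneg _)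
    (Finset.mem_univ j)
  have h3 := le_abs_self (a i - b i)
  have h4 := neg_abs_le (a j - b j)
  linarith

end PartialLabel

theorem theorem4
    {X : Type*} [TopologicalSpace X] [PolishSpace X] [MeasurableSpace X] [BorelSpace X]
    {Y : Type*} [Finite Y] [MeasurableSpace Y] [MeasurableSingletonClass Y]
    {H : Type*} [NormedAddCommGroup H] [InnerProductSpace ℝ H] [CompleteSpace H]
    (loss : Y → Y → ℝ) (hloss : IsProperLoss loss)
    (ψ : Y → H) (φ : Set Y → H)
    (hdec : ∀ (z : Y) (S : Set Y), S.Nonempty → infLoss loss z S = inner ℝ (ψ z) (φ S))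
    (k : X → X → ℝ) (hkpos : IsPosDefKernel k) (hkcont : Continuous fun p : X × X => k p.1 p.2)
    (hkbdd : ∃ B : ℝ, ∀ x y, |k x y| ≤ B) (hkuniv : IsUniversalKernel k)
    (τ : Measure (X × Set Y)) [IsProbabilityMeasure τ]
    (η : ℝ) (hη0 : 0 < η) (hη1 : η < 1) (hτ : StrictlyNonAmbiguous η τ)
    (hg : ∃ G : X → H, MemRKHS k G ∧ ∀ᵐ x ∂τ.fst, condMean τ φ x = G x)
    (ρstar : Measure (X × Y)) (hρ : IsMinVariability loss τ ρstar)
    (fstar : X → Y) (hf : IsRiskMinimizer loss ρstar fstar) :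
    ∃ C : ℝ, ∀ δ : ℝ, 0 < δ → δ < 1 → ∀ n : ℕ, 1 ≤ n →
      ∃ A : Set (Fin n → X × Set Y), MeasurableSet A ∧
        ENNReal.ofReal (1 - δ) ≤ Measure.pi (fun _ : Fin n => τ) A ∧
        ∀ D ∈ A, ∀ fn : X → Y, IsEstimator loss k ((n : ℝ) ^ (-(1 / 2) : ℝ)) D fn →
          risk loss ρstar fn - risk loss ρstar fstar ≤
            C * Real.log (8 / δ) ^ 2 * (n : ℝ) ^ (-(1 / 4) : ℝ) := by
  obtain ⟨G, hG, hGφ⟩ := hg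
  have hρp := hρ.1
  have hYne : Nonempty Y := (nonempty_of_isProbabilityMeasure ρstar).map Prod.snd
  have := Fintype.ofFinite Y
  have hfeq := hρ.ae_eq_of_isRiskMinimizer hloss hτ.1 hf
  have hfst : ρstar.fst = τ.fst := hρ.2.1.fst_eq
  have hcommon := (ae_forall_mem_iff hf.1).1 (hρ.2.1.ae_mem hf.1 hfeq)
  have hsupp : ∀ᵐ x ∂τ.fst, ∀ᵐ S ∂τ.condKernel x, fstar x ∈ S := by
    filter_upwards [hcommon] with x hx
    exact ae_mem_of_mem_commonLabels hx
  have hkrr : ∀ z, _ := fun z => exists_measure_infLoss_error_le τ hkpos hkcont hkbdd hG hGφ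
    (L := infLoss loss z) (ψ z) (by
      filter_upwards [hsupp] with x hx
      filter_upwards [hx] with S hS
      exact hdec z S ⟨_, hS⟩)
  choose C hC0 hC using hkrr
  obtain ⟨C₁, hC₁, hcal⟩ := exists_loss_le_mul_integral_infLoss hloss hη0
  set N := (Fintype.card Y : ℝ)
  have hN : 1 ≤ N := Nat.one_le_cast.2 (Fintype.card_pos (α := Y))
  refine ⟨C₁ * (2 * ∑ z, C z) * (1 + Real.log N) ^ 2, fun δ hδ0 hδ1 n hn => ?_⟩
  have hδN1 : δ / N < 1 := (div_le_self hδ0.le hN).trans_lt hδ1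
  have hδN0 : 0 < δ / N := by positivity
  obtain ⟨A, hA, hAδ, hAD⟩ := exists_measurableSet_forall_of_measure_le _ hδ0
    fun z => hC z (δ / N) hδN0 hδN1 n hn
  refine ⟨A, hA, hAδ, fun D hD fn hfn => ?_⟩
  set a : X → Y → ℝ := fun x z => ∫ S, infLoss loss z S ∂τ.condKernel x
  set b : X → Y → ℝ := fun x z => ∑ i, ridgeWeights k ((n : ℝ) ^ (-(1 / 2) : ℝ))
    (fun j => (D j).1) x i * infLoss loss z (D i).2
  have hint : ∀ z, Integrable (fun x => a x z - b x z) τ.fst := fun z => (hAD D hD z).1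
  have hbound : ∀ z, ∫ x, |a x z - b x z| ∂τ.fst ≤
      C z * Real.log (8 / (δ / N)) ^ 2 * (n : ℝ) ^ (-(1 / 4) : ℝ) := fun z => (hAD D hD z).2
  have hpoint : ∀ᵐ x ∂τ.fst, loss (fn x) (fstar x) ≤ C₁ * (2 * ∑ z, |a x z - b x z|) := by
    filter_upwards [hτ.1, hτ.2, hcommon, hsupp] with x ⟨y, hy⟩ hstrict hx hS
    have hxy : fstar x = y := by simpa [hy] using hx
    refine (hcal (τ.condKernel x) (fstar x) (hxy ▸ hy) hstrict (fn x)).trans ?_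
    -- The infimum risk of the true label vanishes, so the calibration bound is an excess bound.
    have hzero : a x (fstar x) = 0 := by
      refine integral_eq_zero_of_ae ?_
      filter_upwards [hS] with S hS
      exact infLoss_eq_zero hloss hS
    have := sub_le_two_mul_sum_abs_sub (a := a x) (b := b x) (hfn.2 x (fstar x))
    rw [hzero, sub_zero] at this
    gcongr
  have hrisk : risk loss ρstar fn = ∫ x, loss (fn x) (fstar x) ∂τ.fst := by
    rw [← hfst, Measure.fst, integral_map measurable_fst.aemeasurable
      (integrable_loss loss hfn.1 hf.1 (μ := ρstar.fst)).aestronglyMeasurable]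
    refine integral_congr_ae ?_
    filter_upwards [hfeq] with p hp
    rw [hp]
  calc risk loss ρstar fn - risk loss ρstar fstar ≤ risk loss ρstar fn :=
        sub_le_self _ (risk_nonneg hloss _ _)
    _ = ∫ x, loss (fn x) (fstar x) ∂τ.fst := hrisk
    _ ≤ ∫ x, C₁ * (2 * ∑ z, |a x z - b x z|) ∂τ.fst :=
        integral_mono_ae (integrable_loss loss hfn.1 hf.1)
          (((integrable_finsetSum _ fun z _ => (hint z).abs).const_mul 2).const_mul C₁) hpoint
    _ = C₁ * (2 * ∑ z, ∫ x, |a x z - b x z| ∂τ.fst) := by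
        rw [integral_const_mul, integral_const_mul,
          integral_finsetSum _ fun z _ => (hint z).abs]
    _ ≤ C₁ * (2 * ∑ z, C z * ((1 + Real.log N) * Real.log (8 / δ)) ^ 2 *
          (n : ℝ) ^ (-(1 / 4) : ℝ)) := by
        gcongr with z
        refine (hbound z).trans ?_
        gcongr
        · exact hC0 z
        · exact zero_le_one.trans (one_le_log_eight_div hδN0 hδN1.le)
        · exact log_eight_mul_div_le hN hδ0 hδ1.le
    _ = _ := by
        rw [← Finset.sum_mul, ← Finset.sum_mul]
        ring
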